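/- Let $f:\mathbb{R}^D\to\mathbb{R}^D$ be smooth ($C^\infty$), and let $\phi_{t,f}(x)$ denote the solution at time $t$ of $\dot y=f(y)$, $y(0)=x$. Let $a=(a_{ij})\in\mathbb{R}^{I\times I}$, $b\in\mathbb{R}^I$ be the coefficients of a consistent Runge–Kutta scheme, i.e. $\sum_i b_i=1$, and let $L\ge 0$ be an integer. For a vector field $g$, a point $x$ and small $h$, let $$\Phi_{h,g}(x)=x+h\sum_{i=1}^I b_i\,g(v_i),\qquad v_i=x+h\sum_{j=1}^I a_{ij}\,g(v_j)\quad(1\le i\le I),$$ where $(v_i)$ is the solution of the stage equations that tends to $(x,\dots,x)$ as $h\to0$, and let $\Phi^L_{h,g}(x)=x+h\sum_{i=1}^I b_i\,g(v_i^L)$ be its unrolled approximation, where $v_i^0=x$ and, for $l=1,\dots,L$, either $$v_i^l=x+h\sum_{j=1}^I a_{ij}\,g(v_j^{l-1})\qquad\text{(fixed-point iteration)}$$ or $$v_i^l=x+h\sum_{j=1}^I a_{ij}\bigl(g(v_j^{l-1})+g'(v_j^{l-1})(v_j^l-v_j^{l-1})\bigr)\qquad\text{(Newton–Raphson iteration)}.$$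 The inverse modified differential equation (IMDE) of a scheme $\Psi_h$ for $f$ is the formal power series $f_h=\sum_{k\ge0}h^kf_k$ with smooth coefficients $f_k:\mathbb{R}^D\to\mathbb{R}^D$ such that $\Psi_{h,f_h}(x)=\phi_{h,f}(x)$ for every $x\in\mathbb{R}^D$ as formal power series in $h$; that is, for every $x$ and every $N\ge0$, $\Psi_{h,f_h^N}(x)=\phi_{h,f}(x)+\mathcal{O}(h^{N+2})$ as $h\to0$, where $f_h^N=\sum_{k=0}^Nh^kf_k$. Then $\Phi_h$ and $\Phi_h^L$ (for either iteration) each have exactly one IMDE. If $\hat f_h=\sum_k h^k\hat f_k$ is the IMDE of $\Phi_h$ and $f_h=\sum_kh^kf_k$ is the IMDE of $\Phi_h^L$, then $$\hat f_h-f_h=\mathcal{O}(h^{L^*+1}),\quad\text{i.e.}\quad \hat f_k=f_k\ \text{ for } k=0,\dots,L^*,$$ where $L^*=L$ for fixed-point iteration and $L^*=2^{L+1}-2$ for Newton–Raphson iteration. -/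

import Mathlib

open Filter Topology Asymptotics
open scoped ContDiff

namespace UnrolledRK

/-- The state space `ℝ^D`. -/
abbrev State (D : ℕ) := EuclideanSpace ℝ (Fin D)

/-- `y` is the exact solution `t ↦ φ_{t,f}(x)` for `t` near `0`: it solves `y' = f(y)`, `y(0) = x`.
(Only the germ of `y` at `0` is constrained; for `f` of class `C¹` that germ is unique.) -/
def IsExactSolution {D : ℕ} (f : State D → State D) (x : State D) (y : ℝ → State D) : Prop :=
  y 0 = x ∧ ∀ᶠ t in 𝓝 (0 : ℝ), HasDerivAt y (f (y t)) t

/-- The final update `x + h ∑ i, b i • g (v i)` of a Runge-Kutta step with stages `v`. -/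
noncomputable def rkUpdate {D s : ℕ} (b : Fin s → ℝ) (g : State D → State D) (h : ℝ)
    (x : State D) (v : Fin s → State D) : State D :=
  x + h • ∑ i, b i • g (v i)

/-- A numerical one-step scheme, as the relation "`z h = Φ_{h, g h}(x)` for all small `h`" between
an `h`-dependent vector field `g`, an initial value `x` and a curve `z`. -/
abbrev Scheme (D : ℕ) := (ℝ → State D → State D) → State D → (ℝ → State D) → Prop

/-- The Runge-Kutta scheme with coefficients `a`, `b`, whose stages solve
`v i = x + h ∑ j, a i j • g h (v j)` exactly. The stage equations may have solutions far away from
`x`; the scheme uses the one that tends to `x` as `h → 0`. -/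
def exactRK {D s : ℕ} (a : Matrix (Fin s) (Fin s) ℝ) (b : Fin s → ℝ) : Scheme D :=
  fun g x z => ∃ v : ℝ → Fin s → State D,
    Tendsto v (𝓝 0) (𝓝 fun _ => x) ∧
    ∀ᶠ h in 𝓝 (0 : ℝ),
      (∀ i, v h i = x + h • ∑ j, a i j • g h (v h j)) ∧
      z h = rkUpdate b (g h) h x (v h)

/-- The Runge-Kutta scheme unrolled by `L` fixed-point iterations, started at `x`. -/
def fixedPointRK {D s : ℕ} (a : Matrix (Fin s) (Fin s) ℝ) (b : Fin s → ℝ) (L : ℕ) : Scheme D :=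
  fun g x z => ∃ v : ℕ → ℝ → Fin s → State D,
    ∀ᶠ h in 𝓝 (0 : ℝ),
      (∀ i, v 0 h i = x) ∧
      (∀ l < L, ∀ i, v (l + 1) h i = x + h • ∑ j, a i j • g h (v l h j)) ∧
      z h = rkUpdate b (g h) h x (v L h)

/-- The Runge-Kutta scheme unrolled by `L` Newton-Raphson iterations, started at `x`. Each iterate
solves a linear system, which is uniquely solvable for small `h`. -/
def newtonRK {D s : ℕ} (a : Matrix (Fin s) (Fin s) ℝ) (b : Fin s → ℝ) (L : ℕ) : Scheme D :=
  fun g x z => ∃ v : ℕ → ℝ → Fin s → State D,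
    ∀ᶠ h in 𝓝 (0 : ℝ),
      (∀ i, v 0 h i = x) ∧
      (∀ l < L, ∀ i, v (l + 1) h i = x + h • ∑ j, a i j •
        (g h (v l h j) + fderiv ℝ (g h) (v l h j) (v (l + 1) h j - v l h j))) ∧
      z h = rkUpdate b (g h) h x (v L h)

/-- The truncation `f_h^N = ∑_{k ≤ N} h^k f_k` of a formal vector field `∑ h^k f_k`. -/
noncomputable def truncation {D : ℕ} (F : ℕ → State D → State D) (N : ℕ) (h : ℝ) (x : State D) :
    State D :=
  ∑ k ∈ Finset.range (N + 1), h ^ k • F k x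

/-- The curve `c` agrees with the formal power series `∑ h^j d_j` up to and including `h^n`. -/
def ExpandsTo {D : ℕ} (c : ℝ → State D) (d : ℕ → State D) (n : ℕ) : Prop :=
  (fun h : ℝ => c h - ∑ j ∈ Finset.range (n + 1), h ^ j • d j) =O[𝓝 0] fun h : ℝ => h ^ (n + 1)

/-- `∑ h^j d_j` is the formal power series in `h` of `φ_{h,f}(x)`, i.e. its Taylor series. -/
def IsExactSeries {D : ℕ} (f : State D → State D) (x : State D) (d : ℕ → State D) : Prop :=
  ∃ y, IsExactSolution f x y ∧ ∀ n, ExpandsTo y d n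

/-- `∑ h^j d_j` is the formal power series in `h` of `Φ_{h,f_h}(x)`, with `f_h = ∑ h^k f_k` a formal
power series itself. As `Φ_{h,g}(x) = x + h (⋯)`, the coefficients up to `h^(N+1)` involve only
`f_0, …, f_N`, so they are those of `Φ_{h,f_h^N}(x)`. -/
def IsSchemeSeries {D : ℕ} (Φ : Scheme D) (F : ℕ → State D → State D) (x : State D)
    (d : ℕ → State D) : Prop :=
  ∀ N, ∃ z, Φ (truncation F N) x z ∧ ExpandsTo z d (N + 1)

/-- `f_h = ∑ h^k F_k`, with smooth coefficients, is the inverse modified differential equation of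
the scheme `Φ` for the vector field `f`: `Φ_{h,f_h}(x) = φ_{h,f}(x)` for every `x`, as formal power
series in `h`. -/
def IsIMDE {D : ℕ} (Φ : Scheme D) (f : State D → State D) (F : ℕ → State D → State D) : Prop :=
  (∀ k, ContDiff ℝ ∞ (F k)) ∧
  ∀ x, ∃ d, IsExactSeries f x d ∧ IsSchemeSeries Φ F x d

end UnrolledRK

/-! Consistency makes a scheme see a perturbation of its vector field to leading order: replacing
`G` by `G + h ^ N • K` changes the output by `h ^ (N + 1) • K x + O(h ^ (N + 2))`, with factor one
because `∑ b i = 1`. Hence `f_N` can and must be the amount by which the `h ^ (N + 1)` coefficient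
of the scheme, run on the terms already found, misses that of the exact flow. This recursion gives
existence and uniqueness (`IsRegular.exists_correction`, `IsIMDE.eq_of_isBigO`).

All three schemes satisfy this for one reason (`StageForm.isRegular`): their stages solve a system
`V = ι x + h T(h, V)` with `T` smooth and linear in the vector field. For an unrolled scheme, all
iterates together form one such system.

For the comparison, let the stages after `l` iterations be correct up to `O(h ^ p)`. A fixed-point
step improves this to `p + 1`, a Newton step to `2 p + 1`, its linearization error being quadratic.
From `p = 1` this yields `L + 1` and `2 ^ (L + 1) - 1`, that is `L^* + 1`. The update contributes
one more factor `h`, so the schemes agree up to `O(h ^ (L^* + 2))` and the two recursions produce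
the same `f_k` for `k ≤ L^*`. -/

namespace UnrolledRK

/-! ### Asymptotic estimates and Taylor expansion in `h` -/

section Asymptotics

variable {E F P : Type*} [NormedAddCommGroup E] [NormedSpace ℝ E]
  [NormedAddCommGroup F] [NormedSpace ℝ F] [NormedAddCommGroup P] [NormedSpace ℝ P]

theorem isBigO_pow_of_le {m n : ℕ} (hmn : m ≤ n) :
    (fun h : ℝ => h ^ n) =O[𝓝 0] fun h : ℝ => h ^ m :=
  IsBigO.of_bound 1 <| by
    filter_upwards [Metric.ball_mem_nhds (0 : ℝ) one_pos] with h hh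
    rw [norm_pow, norm_pow, one_mul]
    exact pow_le_pow_of_le_one (norm_nonneg h) (mem_ball_zero_iff.1 hh).le hmn

theorem isBigO_smul_pow {u : ℝ → E} {n : ℕ} (hu : u =O[𝓝 0] fun h : ℝ => h ^ n) :
    (fun h => h • u h) =O[𝓝 0] fun h : ℝ => h ^ (n + 1) := by
  simpa [pow_succ'] using (isBigO_refl (fun h : ℝ => h) (𝓝 0)).smul hu

theorem isBigO_pow_smul {u : ℝ → E} (hu : u =O[𝓝 0] fun _ : ℝ => (1 : ℝ)) (n : ℕ) :
    (fun h => h ^ n • u h) =O[𝓝 0] fun h : ℝ => h ^ n := by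
  simpa using (isBigO_refl (fun h : ℝ => h ^ n) (𝓝 0)).smul hu

/-- A term `h • q` with `q = O(e)` can be absorbed into `e`. -/
theorem isBigO_of_eq_add_smul {e r q : ℝ → E}
    (he : ∀ᶠ h in 𝓝 (0 : ℝ), e h = r h + h • q h) (hq : q =O[𝓝 0] e) : e =O[𝓝 0] r := by
  have h1 : (fun h : ℝ => h • q h) =o[𝓝 0] e := by
    have := ((isLittleO_one_iff ℝ).2 (tendsto_id (α := ℝ) (x := 𝓝 0))).smul_isBigO hq
    simpa using this
  refine h1.right_isBigO_sub.trans_eventuallyEq ?_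
  filter_upwards [he] with h hh
  rw [hh]; abel

theorem eq_zero_of_pow_smul_isBigO {n : ℕ} {e : E}
    (h : (fun h : ℝ => h ^ n • e) =O[𝓝 0] fun h : ℝ => h ^ (n + 1)) : e = 0 := by
  have h1 : (fun h : ℝ => h ^ n • e) =O[𝓝[≠] 0] fun h : ℝ => h ^ (n + 1) :=
    h.mono nhdsWithin_le_nhds
  have h2 := (isBigO_refl (fun h : ℝ => (h ^ n)⁻¹) (𝓝[≠] 0)).smul h1
  have h3 : (fun _ : ℝ => e) =O[𝓝[≠] 0] fun h : ℝ => h := by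
    refine (h2.congr' ?_ ?_) <;> filter_upwards [self_mem_nhdsWithin] with t (ht : t ≠ 0)
    · rw [smul_smul, inv_mul_cancel₀ (pow_ne_zero n ht), one_smul]
    · rw [smul_eq_mul, pow_succ, ← mul_assoc, inv_mul_cancel₀ (pow_ne_zero n ht), one_mul]
  have h4 : Tendsto (fun _ : ℝ => e) (𝓝[≠] 0) (𝓝 0) :=
    h3.trans_tendsto (tendsto_id.mono_left nhdsWithin_le_nhds)
  exact tendsto_nhds_unique tendsto_const_nhds h4

/-- Uniqueness of Taylor coefficients: once the lower coefficients agree, the lowest remaining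
difference is a constant times `h ^ j` of size `O(h ^ (j + 1))`, hence zero. -/
theorem coeff_eq_of_isBigO {z : ℝ → E} {c d : ℕ → E} {n : ℕ}
    (hc : (fun h : ℝ => z h - ∑ j ∈ Finset.range n, h ^ j • c j) =O[𝓝 0] fun h : ℝ => h ^ n)
    (hd : (fun h : ℝ => z h - ∑ j ∈ Finset.range n, h ^ j • d j) =O[𝓝 0] fun h : ℝ => h ^ n) :
    ∀ j < n, c j = d j := by
  have hcd : (fun h : ℝ => ∑ j ∈ Finset.range n, h ^ j • (c j - d j)) =O[𝓝 0]
      fun h : ℝ => h ^ n := by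
    refine (hd.sub hc).congr_left fun h => ?_
    simp only [smul_sub, Finset.sum_sub_distrib]; abel
  intro j
  induction j using Nat.strong_induction_on with
  | _ j ih =>
    intro hj
    rw [← sub_eq_zero]
    refine eq_zero_of_pow_smul_isBigO (n := j) ?_
    have h1 : (fun h : ℝ => ∑ i ∈ Finset.Ico (j + 1) n, h ^ i • (c i - d i)) =O[𝓝 0]
        fun h : ℝ => h ^ (j + 1) := by
      refine IsBigO.fun_sum fun i hi => ?_
      exact (isBigO_pow_smul (u := fun _ => c i - d i) (isBigO_const_const _ one_ne_zero _) i).trans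
        (isBigO_pow_of_le (Finset.mem_Ico.1 hi).1)
    refine ((hcd.trans (isBigO_pow_of_le hj)).sub h1).congr_left fun h => ?_
    rw [← Finset.sum_range_add_sum_Ico _ (Nat.succ_le_of_lt hj), add_sub_cancel_right,
      Finset.sum_range_succ, Finset.sum_eq_zero, zero_add]
    intro i hi
    rw [ih i (Finset.mem_range.1 hi) ((Finset.mem_range.1 hi).trans hj), sub_self, smul_zero]

/-- Strict differentiability at `p` is what allows both arguments to move. -/
theorem isBigO_comp_sub_comp {f : P → F} {p : P} (hf : ContDiff ℝ ∞ f) {u v : ℝ → P}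
    (hu : Tendsto u (𝓝 0) (𝓝 p)) (hv : Tendsto v (𝓝 0) (𝓝 p)) :
    (fun h => f (u h) - f (v h)) =O[𝓝 0] fun h => u h - v h := by
  have := (hf.contDiffAt (x := p)).hasStrictFDerivAt (by simp)
  exact this.isBigO_sub.comp_tendsto (hu.prodMk_nhds hv)

theorem isBigO_family_sub {G : ℝ → E → F} (hG : ContDiff ℝ ∞ (Function.uncurry G)) {p : E}
    {u v : ℝ → E} (hu : Tendsto u (𝓝 0) (𝓝 p)) (hv : Tendsto v (𝓝 0) (𝓝 p)) :
    (fun h => G h (u h) - G h (v h)) =O[𝓝 0] fun h => u h - v h := by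
  have := isBigO_comp_sub_comp hG (tendsto_id.prodMk_nhds hu) (tendsto_id.prodMk_nhds hv)
  refine this.trans (IsBigO.of_norm_left ?_)
  simpa [Prod.norm_def] using (isBigO_refl (fun h => u h - v h) (𝓝 0)).norm_left

theorem tendsto_family {G : ℝ → E → F} (hG : ContDiff ℝ ∞ (Function.uncurry G)) {p : E}
    {u : ℝ → E} (hu : Tendsto u (𝓝 0) (𝓝 p)) :
    Tendsto (fun h => G h (u h)) (𝓝 0) (𝓝 (G 0 p)) :=
  (hG.continuous.tendsto (0, p)).comp (tendsto_id.prodMk_nhds hu)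

theorem isBigO_family_one {G : ℝ → E → F} (hG : ContDiff ℝ ∞ (Function.uncurry G)) {p : E}
    {u : ℝ → E} (hu : Tendsto u (𝓝 0) (𝓝 p)) :
    (fun h => G h (u h)) =O[𝓝 0] fun _ : ℝ => (1 : ℝ) :=
  (tendsto_family hG hu).isBigO_one ℝ

theorem contDiff_family_fderiv {G : ℝ → E → F} (hG : ContDiff ℝ ∞ (Function.uncurry G)) :
    ContDiff ℝ ∞ (Function.uncurry fun h x => fderiv ℝ (G h) x) :=
  ContDiff.fderiv (f := fun (p : ℝ × E) x => G p.1 x) (g := fun p => p.2)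
    (hG.comp ((contDiff_fst.comp contDiff_fst).prodMk contDiff_snd)) contDiff_snd (by simp)

theorem contDiff_family_apply {G : ℝ → E → F} (hG : ContDiff ℝ ∞ (Function.uncurry G)) (h : ℝ) :
    ContDiff ℝ ∞ (G h) :=
  hG.comp (contDiff_const.prodMk contDiff_id)

theorem isBigO_family_fderiv_apply {G : ℝ → E → F} (hG : ContDiff ℝ ∞ (Function.uncurry G))
    {p : E} {u : ℝ → E} (hu : Tendsto u (𝓝 0) (𝓝 p)) (e : ℝ → E) :
    (fun h => fderiv ℝ (G h) (u h) (e h)) =O[𝓝 0] e := by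
  have h1 := isBigO_family_one (contDiff_family_fderiv hG) hu
  have h2 : (fun h => fderiv ℝ (G h) (u h) (e h)) =O[𝓝 0]
      fun h => ‖fderiv ℝ (G h) (u h)‖ * ‖e h‖ :=
    IsBigO.of_norm_le fun h => ContinuousLinearMap.le_opNorm _ _
  refine h2.trans ?_
  simpa using h1.norm_left.mul (isBigO_refl (fun h => ‖e h‖) (𝓝 0))

/-- The first order Taylor remainder of a smooth family is locally uniformly quadratic. -/
theorem isBigO_family_taylor {G : ℝ → E → F} (hG : ContDiff ℝ ∞ (Function.uncurry G)) {p : E}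
    {u v : ℝ → E} (hu : Tendsto u (𝓝 0) (𝓝 p)) (hv : Tendsto v (𝓝 0) (𝓝 p)) :
    (fun h => G h (u h) - G h (v h) - fderiv ℝ (G h) (v h) (u h - v h)) =O[𝓝 0]
      fun h => ‖u h - v h‖ ^ 2 := by
  -- The derivative is Lipschitz near `(0, p)` jointly in parameter and point, so one constant
  -- serves all small `h`.
  obtain ⟨K, t, ht, hK⟩ := (((contDiff_family_fderiv hG).of_le
    (m := 1) (by exact_mod_cast le_top)).contDiffAt (x := ((0 : ℝ), p))).exists_lipschitzOnWith
  obtain ⟨r, hr, hrt⟩ := Metric.mem_nhds_iff.1 ht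
  refine IsBigO.of_bound K ?_
  filter_upwards [hu (Metric.ball_mem_nhds p hr), hv (Metric.ball_mem_nhds p hr),
    Metric.ball_mem_nhds (0 : ℝ) hr] with h hhu hhv hh
  have hmem : ∀ y ∈ Metric.ball p r, (h, y) ∈ t := fun y hy =>
    hrt (by rw [← ball_prod_same]; exact ⟨hh, hy⟩)
  have hseg : segment ℝ (v h) (u h) ⊆ Metric.ball p r :=
    (convex_ball p r).segment_subset hhv hhu
  have key := (convex_segment (v h) (u h)).norm_image_sub_le_of_norm_fderiv_le' (𝕜 := ℝ)
    (f := G h) (φ := fderiv ℝ (G h) (v h)) (C := K * ‖u h - v h‖)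
    (fun y _ => (contDiff_family_apply hG h).differentiable (by simp) y)
    (fun y hy => by
      have := hK.dist_le_mul _ (hmem y (hseg hy)) _ (hmem (v h) hhv)
      rw [dist_eq_norm, dist_eq_norm] at this
      refine this.trans ?_
      have h2 : ‖y - v h‖ ≤ ‖u h - v h‖ := by
        obtain ⟨θ, ⟨h0, h1⟩, rfl⟩ := (segment_eq_image' ℝ (v h) (u h) ▸ hy)
        rw [add_sub_cancel_left, norm_smul, Real.norm_of_nonneg h0]
        exact mul_le_of_le_one_left (norm_nonneg _) h1
      gcongr
      simpa [Prod.norm_def] using h2)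
    (left_mem_segment ℝ _ _) (right_mem_segment ℝ _ _)
  refine key.trans (le_of_eq ?_)
  rw [norm_pow, norm_norm]; ring

/-- Mean value inequality on the ball of radius `‖h‖`, where `c'` is at most `C * ‖h‖ ^ n`. -/
theorem isBigO_pow_succ_of_hasDerivAt {c c' : ℝ → E} {n : ℕ} (h0 : c 0 = 0)
    (hc : ∀ᶠ h in 𝓝 (0 : ℝ), HasDerivAt c (c' h) h) (hO : c' =O[𝓝 0] fun h : ℝ => h ^ n) :
    c =O[𝓝 0] fun h : ℝ => h ^ (n + 1) := by
  obtain ⟨C, hC, hb⟩ := hO.exists_pos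
  obtain ⟨r, hr, hrt⟩ := Metric.eventually_nhds_iff_ball.1 (hc.and hb.bound)
  refine IsBigO.of_bound C ?_
  filter_upwards [Metric.ball_mem_nhds (0 : ℝ) hr] with h hh
  have hsub : Metric.closedBall (0 : ℝ) ‖h‖ ⊆ Metric.ball 0 r := fun t ht => by
    rw [mem_ball_zero_iff] at hh ⊢
    exact (mem_closedBall_zero_iff.1 ht).trans_lt hh
  have key := (convex_closedBall (0 : ℝ) ‖h‖).norm_image_sub_le_of_norm_hasDerivWithin_le
    (f := c) (f' := c') (C := C * ‖h‖ ^ n)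
    (fun t ht => (hrt t (hsub ht)).1.hasDerivWithinAt)
    (fun t ht => (hrt t (hsub ht)).2.trans (by
      rw [norm_pow]
      have := mem_closedBall_zero_iff.1 ht
      gcongr))
    (Metric.mem_closedBall_self (norm_nonneg h))
    (mem_closedBall_zero_iff.2 le_rfl)
  rw [h0, sub_zero, sub_zero] at key
  rw [norm_pow, pow_succ, ← mul_assoc]
  exact key

/-- Taylor's formula for a chain of successive derivatives. -/
theorem isBigO_taylor {c : ℕ → ℝ → E}
    (hc : ∀ j, ∀ᶠ h in 𝓝 (0 : ℝ), HasDerivAt (c j) (c (j + 1) h) h) (n : ℕ) :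
    (fun h : ℝ => c 0 h - ∑ j ∈ Finset.range n, h ^ j • ((j.factorial : ℝ)⁻¹ • c j 0)) =O[𝓝 0]
      fun h : ℝ => h ^ n := by
  induction n generalizing c with
  | zero =>
    simpa using (hc 0).self_of_nhds.continuousAt.tendsto.isBigO_one ℝ
  | succ n ih =>
    have h1 := ih (c := fun j => c (j + 1)) fun j => hc (j + 1)
    refine isBigO_pow_succ_of_hasDerivAt ?_ ?_ h1
    · rw [Finset.sum_range_succ', Finset.sum_eq_zero]
      · simp
      · intro i _; simp
    · filter_upwards [hc 0] with h hh
      refine hh.fun_sub ?_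
      simp only [Finset.sum_range_succ' (n := n), pow_zero]
      rw [hasDerivAt_add_const_iff]
      refine HasDerivAt.fun_sum fun i _ => ?_
      have := (hasDerivAt_pow (i + 1) h).smul_const (((i + 1).factorial : ℝ)⁻¹ • c (i + 1) 0)
      convert! this using 1
      rw [smul_smul, smul_smul, Nat.factorial_succ]
      congr 1
      push_cast
      have : (i.factorial : ℝ) ≠ 0 := by positivity
      have : (i : ℝ) + 1 ≠ 0 := by positivity
      field_simp

/-- The derivative of a family in its parameter. -/
noncomputable def paramDeriv (Z : ℝ → E → F) (h : ℝ) (x : E) : F :=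
  deriv (fun t => Z t x) h

theorem contDiff_paramDeriv {Z : ℝ → E → F} (hZ : ContDiff ℝ ∞ (Function.uncurry Z)) :
    ContDiff ℝ ∞ (Function.uncurry (paramDeriv Z)) :=
  ContDiff.fderiv_apply (f := fun (p : ℝ × E) t => Z t p.2) (g := fun p => p.1) (k := fun _ => 1)
    (hZ.comp (contDiff_snd.prodMk (contDiff_snd.comp contDiff_fst))) contDiff_fst contDiff_const
    (by simp)

/-- The Taylor coefficients of a smooth family in its parameter are smooth. -/
theorem exists_contDiff_coeff {Z : ℝ → E → F} (hZ : ContDiff ℝ ∞ (Function.uncurry Z)) :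
    ∃ c : ℕ → E → F, (∀ j, ContDiff ℝ ∞ (c j)) ∧ ∀ x n,
      (fun h : ℝ => Z h x - ∑ j ∈ Finset.range n, h ^ j • c j x) =O[𝓝 0] fun h : ℝ => h ^ n := by
  have hsm : ∀ j, ContDiff ℝ ∞ (Function.uncurry (paramDeriv^[j] Z)) := fun j => by
    induction j with
    | zero => exact hZ
    | succ j ih => rw [Function.iterate_succ_apply']; exact contDiff_paramDeriv ih
  refine ⟨fun j x => (j.factorial : ℝ)⁻¹ • (paramDeriv^[j] Z) 0 x, fun j => ?_, fun x n => ?_⟩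
  · exact contDiff_const.smul ((hsm j).comp (contDiff_const.prodMk contDiff_id))
  · refine isBigO_taylor (c := fun j h => (paramDeriv^[j] Z) h x) (fun j => .of_forall fun h => ?_) n
    rw [Function.iterate_succ_apply']
    have h1 : ContDiff ℝ ∞ fun t => (paramDeriv^[j] Z) t x :=
      (hsm j).comp (contDiff_id.prodMk contDiff_const)
    exact (h1.differentiable (by simp) h).hasDerivAt

end Asymptotics

/-! ### Taylor series of the exact flow -/

section ExactFlow

variable {D : ℕ} {f : State D → State D}

/-- The iterated Lie derivatives of the identity along `f`. -/
noncomputable def lieIterate (f : State D → State D) : ℕ → State D → State D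
  | 0 => id
  | j + 1 => fun x => fderiv ℝ (lieIterate f j) x (f x)

/-- The Taylor coefficients of the exact flow of `f`. -/
noncomputable def flowCoeff (f : State D → State D) (j : ℕ) (x : State D) : State D :=
  (j.factorial : ℝ)⁻¹ • lieIterate f j x

theorem contDiff_lieIterate (hf : ContDiff ℝ ∞ f) (j : ℕ) : ContDiff ℝ ∞ (lieIterate f j) := by
  induction j with
  | zero => exact contDiff_id
  | succ j ih => exact (ih.fderiv_right (m := ∞) (by simp)).clm_apply hf

theorem contDiff_flowCoeff (hf : ContDiff ℝ ∞ f) (j : ℕ) : ContDiff ℝ ∞ (flowCoeff f j) :=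
  (contDiff_lieIterate hf j).const_smul (j.factorial : ℝ)⁻¹

/-- By the chain rule the successive derivatives of `y` are `lieIterate f j (y h)`, so Taylor's
formula for chains applies. -/
theorem IsExactSolution.isBigO_sub (hf : ContDiff ℝ ∞ f) {x : State D} {y : ℝ → State D}
    (hy : IsExactSolution f x y) (n : ℕ) :
    (fun h : ℝ => y h - ∑ j ∈ Finset.range n, h ^ j • flowCoeff f j x) =O[𝓝 0]
      fun h : ℝ => h ^ n := by
  have := isBigO_taylor (c := fun j h => lieIterate f j (y h)) (fun j => ?_) n
  · simp only [hy.1] at this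
    exact this
  · filter_upwards [hy.2] with h hh
    exact ((contDiff_lieIterate hf j).differentiable (by simp) (y h)).hasFDerivAt.comp_hasDerivAt
      h hh

theorem exists_isExactSolution (hf : ContDiff ℝ ∞ f) (x : State D) :
    ∃ y, IsExactSolution f x y := by
  obtain ⟨y, h0, ε, hε, hy⟩ := ContDiffAt.exists_forall_mem_closedBall_exists_eq_forall_mem_Ioo_hasDerivAt₀
    ((hf.of_le (m := 1) (by exact_mod_cast le_top)).contDiffAt (x := x)) 0
  refine ⟨y, h0, ?_⟩
  filter_upwards [Ioo_mem_nhds (show (0 : ℝ) - ε < 0 by linarith) (show 0 < 0 + ε by linarith)]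
    with t ht using hy t ht

theorem isExactSeries_flowCoeff (hf : ContDiff ℝ ∞ f) (x : State D) :
    IsExactSeries f x fun j => flowCoeff f j x := by
  obtain ⟨y, hy⟩ := exists_isExactSolution hf x
  exact ⟨y, hy, fun n => hy.isBigO_sub hf (n + 1)⟩

theorem IsExactSeries.eq_flowCoeff (hf : ContDiff ℝ ∞ f) {x : State D} {d : ℕ → State D}
    (hd : IsExactSeries f x d) : d = fun j => flowCoeff f j x := by
  obtain ⟨y, hy, hyd⟩ := hd
  funext j
  exact coeff_eq_of_isBigO (hyd j) (hy.isBigO_sub hf (j + 1)) j (Nat.lt_succ_self j)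

end ExactFlow

/-! ### Implicit stage systems -/

section ImplicitStages

variable {W : Type*} [NormedAddCommGroup W] [NormedSpace ℝ W]

/-- `V` is the branch through `w` of the solutions of `V = w + h T(h, V)`. -/
def IsBranch (T : ℝ → W → W) (w : W) (V : ℝ → W) : Prop :=
  Tendsto V (𝓝 0) (𝓝 w) ∧ ∀ᶠ h in 𝓝 (0 : ℝ), V h = w + h • T h (V h)

/-- Implicit function theorem for `v - h • T h v`, whose partial derivative in `v` at `h = 0` is the
identity. -/
theorem exists_isBranch [CompleteSpace W] {T : ℝ → W → W}
    (hT : ContDiff ℝ ∞ (Function.uncurry T)) (w : W) : ∃ V, IsBranch T w V := by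
  let R : ℝ × W → W := fun p => p.2 - p.1 • T p.1 p.2
  have hRs : ContDiff ℝ ∞ R := contDiff_snd.sub (contDiff_fst.smul hT)
  have hR := (hRs.contDiffAt (x := ((0 : ℝ), w))).hasStrictFDerivAt (by simp)
  have hinr : fderiv ℝ R (0, w) ∘L .inr ℝ ℝ W = .id ℝ W := by
    have h1 : HasFDerivAt (fun v : W => R (0, v)) (fderiv ℝ R (0, w) ∘L .inr ℝ ℝ W) w :=
      hR.hasFDerivAt.comp w (hasFDerivAt_prodMk_right (0 : ℝ) w)
    have h2 : (fun v : W => R (0, v)) = id := by funext v; simp [R]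
    rw [h2] at h1
    exact h1.unique (hasFDerivAt_id w)
  have hinv : (fderiv ℝ R (0, w) ∘L .inr ℝ ℝ W).IsInvertible := by
    rw [hinr]; exact ⟨.refl ℝ W, rfl⟩
  refine ⟨hR.implicitFunctionOfProdDomain hinv, hR.tendsto_implicitFunctionOfProdDomain hinv, ?_⟩
  filter_upwards [hR.eventually_apply_implicitFunctionOfProdDomain hinv] with h hh
  simpa [R, sub_eq_iff_eq_add] using hh

theorem IsBranch.isBigO_sub {T : ℝ → W → W} (hT : ContDiff ℝ ∞ (Function.uncurry T)) {w : W}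
    {V : ℝ → W} (hV : IsBranch T w V) : (fun h => V h - w) =O[𝓝 0] fun h : ℝ => h ^ 1 := by
  have h1 : (fun h => T h (V h)) =O[𝓝 0] fun h : ℝ => h ^ 0 := by
    simpa using isBigO_family_one hT hV.1
  refine (isBigO_smul_pow h1).congr' ?_ .rfl
  filter_upwards [hV.2] with h hh
  rw [eq_comm, sub_eq_iff_eq_add', ← hh]

/-- Branches depend stably on the right-hand side. -/
theorem IsBranch.isBigO_sub_of_perturb {T S T' : ℝ → W → W}
    (hT : ContDiff ℝ ∞ (Function.uncurry T)) (hS : ContDiff ℝ ∞ (Function.uncurry S)) {N : ℕ}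
    (hT' : ∀ h v, T' h v = T h v + h ^ N • S h v) {w : W} {V V' : ℝ → W}
    (hV : IsBranch T w V) (hV' : IsBranch T' w V') :
    (fun h => V' h - V h) =O[𝓝 0] fun h : ℝ => h ^ (N + 1) := by
  -- The difference is `h • (T h (V' h) - T h (V h))`, absorbed by the Lipschitz bound, plus `h • h
  -- ^ N • S h (V' h)`.
  refine (isBigO_of_eq_add_smul (r := fun h => h • h ^ N • S h (V' h)) ?_
    (isBigO_family_sub hT hV'.1 hV.1)).trans
    (isBigO_smul_pow (isBigO_pow_smul (isBigO_family_one hS hV'.1) N))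
  filter_upwards [hV.2, hV'.2] with h h1 h2
  calc V' h - V h = (w + h • T' h (V' h)) - (w + h • T h (V h)) := by rw [← h1, ← h2]
    _ = _ := by rw [hT', smul_add, smul_sub]; abel

/-- The Picard iterates of `V = w + h T(h, V)`. -/
noncomputable def picardStage (T : ℝ → W → W) : ℕ → ℝ → W → W
  | 0 => fun _ w => w
  | n + 1 => fun h w => w + h • T h (picardStage T n h w)

theorem contDiff_picardStage {T : ℝ → W → W} (hT : ContDiff ℝ ∞ (Function.uncurry T)) (n : ℕ) :
    ContDiff ℝ ∞ (Function.uncurry (picardStage T n)) := by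
  induction n with
  | zero => exact contDiff_snd
  | succ n ih =>
    exact contDiff_snd.add (contDiff_fst.smul (hT.comp (contDiff_fst.prodMk ih)))

theorem tendsto_picardStage {T : ℝ → W → W} (hT : ContDiff ℝ ∞ (Function.uncurry T)) (n : ℕ)
    (w : W) : Tendsto (fun h => picardStage T n h w) (𝓝 0) (𝓝 w) := by
  have h0 : picardStage T n 0 w = w := by cases n <;> simp [picardStage]
  have := tendsto_family (contDiff_picardStage hT n) (tendsto_const_nhds (x := w))
  rwa [h0] at this

/-- A branch is obtained for each `w` separately, with no smoothness in `w`. Picard iterates are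
smooth in `(h, w)` and replace it to any order, each step gaining a factor `h`. -/
theorem IsBranch.isBigO_sub_picardStage {T : ℝ → W → W}
    (hT : ContDiff ℝ ∞ (Function.uncurry T)) {w : W} {V : ℝ → W} (hV : IsBranch T w V) (n : ℕ) :
    (fun h => V h - picardStage T n h w) =O[𝓝 0] fun h : ℝ => h ^ (n + 1) := by
  induction n with
  | zero => exact hV.isBigO_sub hT
  | succ n ih =>
    refine (isBigO_smul_pow ((isBigO_family_sub hT hV.1
      (tendsto_picardStage hT n w)).trans ih)).congr' ?_ .rfl
    filter_upwards [hV.2] with h hh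
    calc h • (T h (V h) - T h (picardStage T n h w))
        = (w + h • T h (V h)) - picardStage T (n + 1) h w := by
          simp only [picardStage, smul_sub]; abel
      _ = V h - picardStage T (n + 1) h w := by rw [← hh]

end ImplicitStages

/-! ### Regular schemes -/

section Regular

variable {D s : ℕ}

/-- The properties of a one-step scheme from which its inverse modified equation is built: smooth
expansions exist, and a perturbation `h ^ N • K` of the vector field is seen to leading order. -/
structure IsRegular (Φ : Scheme D) : Prop where
  exists_coeff : ∀ G, ContDiff ℝ ∞ (Function.uncurry G) → ∀ n : ℕ,
    ∃ c : ℕ → State D → State D, (∀ j, ContDiff ℝ ∞ (c j)) ∧ ∀ x, ∃ z, Φ G x z ∧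
      (fun h : ℝ => z h - ∑ j ∈ Finset.range n, h ^ j • c j x) =O[𝓝 0] fun h : ℝ => h ^ n
  isBigO_perturb : ∀ (G : ℝ → State D → State D) (K : State D → State D) (N : ℕ),
    ContDiff ℝ ∞ (Function.uncurry G) → ContDiff ℝ ∞ K → ∀ x z z', Φ G x z →
      Φ (fun h x => G h x + h ^ N • K x) x z' →
      (fun h : ℝ => z' h - z h - h ^ (N + 1) • K x) =O[𝓝 0] fun h : ℝ => h ^ (N + 2)
  isBigO_sub : ∀ G, ContDiff ℝ ∞ (Function.uncurry G) → ∀ x z, Φ G x z →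
    (fun h : ℝ => z h - x) =O[𝓝 0] fun h : ℝ => h ^ 1

theorem contDiff_perturb {G : ℝ → State D → State D} {K : State D → State D}
    (hG : ContDiff ℝ ∞ (Function.uncurry G)) (hK : ContDiff ℝ ∞ K) (N : ℕ) :
    ContDiff ℝ ∞ (Function.uncurry fun h x => G h x + h ^ N • K x) :=
  hG.add ((contDiff_fst.pow N).smul (hK.comp contDiff_snd))

/-- A presentation of a scheme by a system `V = ι x + h T(h, V)` for all its stages together, the
last of which are read off by `π`. -/
structure StageForm (b : Fin s → ℝ) (Φ : Scheme D) (W : Type*) [NormedAddCommGroup W]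
    [NormedSpace ℝ W] where
  ι : State D →L[ℝ] W
  π : W →L[ℝ] (Fin s → State D)
  T : (ℝ → State D → State D) → ℝ → W → W
  π_ι : ∀ x i, π (ι x) i = x
  contDiff_T : ∀ G, ContDiff ℝ ∞ (Function.uncurry G) → ContDiff ℝ ∞ (Function.uncurry (T G))
  T_perturb : ∀ (G : ℝ → State D → State D) (K : State D → State D) (N : ℕ),
    ContDiff ℝ ∞ (Function.uncurry G) → ContDiff ℝ ∞ K → ∀ h V,
      T (fun h x => G h x + h ^ N • K x) h V = T G h V + h ^ N • T (fun _ => K) h V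
  scheme_iff : ∀ G, ContDiff ℝ ∞ (Function.uncurry G) → ∀ x z,
    Φ G x z ↔ ∃ V, IsBranch (T G) (ι x) V ∧ ∀ᶠ h in 𝓝 (0 : ℝ), z h = rkUpdate b (G h) h x (π (V h))

theorem isBigO_sum_smul {ι F : Type*} [NormedAddCommGroup F] (t : Finset ι) (c : ι → ℝ)
    {u : ι → ℝ → State D} {g : ℝ → F} (hu : ∀ i, u i =O[𝓝 0] g) :
    (fun h => ∑ i ∈ t, c i • u i h) =O[𝓝 0] g :=
  IsBigO.fun_sum fun i _ => (hu i).const_smul_left (c i)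

/-- Smooth coefficients come from the scheme evaluated on Picard iterates. Perturbing the field by
`h ^ N • K` moves the stages only by `O(h ^ (N + 1))`, hence the output through `G` by `O(h ^ (N +
2))`; what remains is `h ^ (N + 1)` times the `b`-average of `K` at stages within `O(h)` of `x`. -/
theorem StageForm.isRegular {b : Fin s → ℝ} {Φ : Scheme D} {W : Type*} [NormedAddCommGroup W]
    [NormedSpace ℝ W] [CompleteSpace W] (S : StageForm b Φ W) (hb : ∑ i, b i = 1) :
    IsRegular Φ := by
  have tend : ∀ {x : State D} {V : ℝ → W}, Tendsto V (𝓝 0) (𝓝 (S.ι x)) → ∀ i,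
      Tendsto (fun h => S.π (V h) i) (𝓝 0) (𝓝 x) := by
    intro x V hV i
    have := ((continuous_apply i).comp S.π.continuous).continuousAt.tendsto.comp hV
    simpa only [Function.comp_def, S.π_ι] using this
  have bigO : ∀ {V V' : ℝ → W} (i : Fin s),
      (fun h => S.π (V' h) i - S.π (V h) i) =O[𝓝 0] fun h => V' h - V h := by
    intro V V' i
    have := S.π.isBigO_comp (fun h => V' h - V h) (𝓝 0)
    simpa using (isBigO_pi.1 this) i
  refine ⟨fun G hG n => ?_, fun G K N hG hK x z z' hz hz' => ?_, fun G hG x z hz => ?_⟩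
  · let Q : ℝ → State D → W := fun h x => picardStage (S.T G) n h (S.ι x)
    have hQ : ContDiff ℝ ∞ (Function.uncurry Q) :=
      (contDiff_picardStage (S.contDiff_T G hG) n).comp
        (contDiff_fst.prodMk (S.ι.contDiff.comp contDiff_snd))
    have hZ : ContDiff ℝ ∞ (Function.uncurry fun h x => rkUpdate b (G h) h x (S.π (Q h x))) := by
      change ContDiff ℝ ∞ fun p : ℝ × State D => p.2 + p.1 • ∑ i, b i • G p.1 (S.π (Q p.1 p.2) i)
      refine contDiff_snd.add (contDiff_fst.smul (ContDiff.sum fun i _ => ?_))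
      have hi := contDiff_pi.1 (S.π.contDiff.comp hQ) i
      exact ContDiff.const_smul (b i) (hG.comp (contDiff_fst.prodMk hi))
    obtain ⟨c, hc, hcZ⟩ := exists_contDiff_coeff hZ
    refine ⟨c, hc, fun x => ?_⟩
    obtain ⟨V, hV⟩ := exists_isBranch (S.contDiff_T G hG) (S.ι x)
    refine ⟨_, (S.scheme_iff G hG x _).2 ⟨V, hV, .of_forall fun h => rfl⟩, ?_⟩
    have h1 : ∀ i, (fun h => G h (S.π (V h) i) - G h (S.π (Q h x) i)) =O[𝓝 0]
        fun h : ℝ => h ^ (n + 1) := fun i =>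
      ((isBigO_family_sub hG (tend hV.1 i)
        (tend (tendsto_picardStage (S.contDiff_T G hG) n _) i)).trans (bigO i)).trans
        (hV.isBigO_sub_picardStage (S.contDiff_T G hG) n)
    have h2 := (isBigO_smul_pow (isBigO_sum_smul Finset.univ b h1)).trans
      (isBigO_pow_of_le (show n ≤ n + 1 + 1 by lia))
    refine (h2.add (hcZ x n)).congr_left fun h => ?_
    simp only [rkUpdate, smul_sub, Finset.sum_sub_distrib]
    abel
  · obtain ⟨V, hV, hzV⟩ := (S.scheme_iff _ hG x z).1 hz
    obtain ⟨V', hV', hzV'⟩ := (S.scheme_iff _ (contDiff_perturb hG hK N) x z').1 hz'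
    have hKc : ContDiff ℝ ∞ (Function.uncurry fun (_ : ℝ) => K) := hK.comp contDiff_snd
    have hd := IsBranch.isBigO_sub_of_perturb (S.contDiff_T G hG) (S.contDiff_T _ hKc)
      (S.T_perturb G K N hG hK) hV hV'
    have h1 : ∀ i, (fun h => G h (S.π (V' h) i) - G h (S.π (V h) i)) =O[𝓝 0]
        fun h : ℝ => h ^ (N + 1) := fun i =>
      ((isBigO_family_sub hG (tend hV'.1 i) (tend hV.1 i)).trans (bigO i)).trans hd
    have h2 : ∀ i, (fun h => K (S.π (V' h) i) - K x) =O[𝓝 0] fun h : ℝ => h ^ 1 := fun i => by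
      refine (isBigO_comp_sub_comp hK (tend hV'.1 i) tendsto_const_nhds).trans ?_
      have h3 := (bigO (V := fun _ => S.ι x) (V' := V') i).trans
        (hV'.isBigO_sub (S.contDiff_T _ (contDiff_perturb hG hK N)))
      simpa only [S.π_ι] using h3
    have h4 := isBigO_smul_pow (isBigO_sum_smul Finset.univ b h1)
    have h5 := (isBigO_refl (fun h : ℝ => h ^ (N + 1)) (𝓝 0)).smul
      (isBigO_sum_smul Finset.univ b h2)
    simp only [smul_eq_mul, ← pow_add] at h5
    refine (h4.add h5).congr' ?_ .rfl
    filter_upwards [hzV, hzV'] with h e1 e2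
    have e3 : h • ∑ i, b i • h ^ N • K (S.π (V' h) i) =
        h ^ (N + 1) • ∑ i, b i • K (S.π (V' h) i) := by
      simp only [Finset.smul_sum, smul_smul]
      exact Finset.sum_congr rfl fun i _ => by congr 1; ring
    -- Consistency enters here: `hb` turns `∑ b i • K x` into `K x`.
    simp only [e1, e2, rkUpdate, smul_sub, smul_add, Finset.sum_sub_distrib,
      Finset.sum_add_distrib, ← Finset.sum_smul, hb, one_smul, e3]
    abel
  · obtain ⟨V, hV, hzV⟩ := (S.scheme_iff _ hG x z).1 hz
    have h1 : ∀ i, (fun h => G h (S.π (V h) i)) =O[𝓝 0] fun h : ℝ => h ^ 0 := fun i => by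
      simpa using isBigO_family_one hG (tend hV.1 i)
    refine (isBigO_smul_pow (isBigO_sum_smul Finset.univ b h1)).congr' ?_ .rfl
    filter_upwards [hzV] with h e1
    rw [e1, rkUpdate, add_sub_cancel_left]

end Regular

/-! ### The three schemes and the order of their stages -/

section Schemes

variable {D s : ℕ} (a : Matrix (Fin s) (Fin s) ℝ) (b : Fin s → ℝ)

theorem contDiff_sum_family_apply {W : Type*} [NormedAddCommGroup W] [NormedSpace ℝ W]
    {H : Fin s → ℝ × W → State D} (hH : ∀ j, ContDiff ℝ ∞ (H j)) (c : Fin s → ℝ) :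
    ContDiff ℝ ∞ fun p => ∑ j, c j • H j p :=
  ContDiff.sum fun j _ => (hH j).const_smul (c j)

/-- The exact stages as a `StageForm`. -/
noncomputable def exactStageForm :
    StageForm b (exactRK (D := D) a b) (Fin s → State D) where
  ι := ContinuousLinearMap.pi fun _ => .id ℝ _
  π := .id ℝ _
  T G h V i := ∑ j, a i j • G h (V j)
  π_ι _ _ := rfl
  contDiff_T G hG := contDiff_pi.2 fun i => contDiff_sum_family_apply (fun j =>
    hG.comp (contDiff_fst.prodMk ((contDiff_apply ℝ _ j).comp contDiff_snd))) (a i)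
  T_perturb G K N _ _ h V := by
    funext i
    simp only [Pi.add_apply, Pi.smul_apply, smul_add, Finset.sum_add_distrib, Finset.smul_sum]
    congr 1
    exact Finset.sum_congr rfl fun j _ => smul_comm _ _ _
  scheme_iff G _ x z := by
    refine exists_congr fun V => ?_
    rw [IsBranch, and_assoc, ← eventually_and]
    refine and_congr Iff.rfl (eventually_congr (.of_forall fun h => ?_))
    rw [funext_iff]
    rfl

/-- The common form of the unrolled schemes: fixed-point iteration for `ε = 0` and Newton-Raphson
iteration for `ε = 1`. -/
def IsUnrolled (ε : ℝ) (L : ℕ) (g : ℝ → State D → State D) (x : State D)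
    (v : ℕ → ℝ → Fin s → State D) : Prop :=
  ∀ᶠ h in 𝓝 (0 : ℝ), (∀ i, v 0 h i = x) ∧
    ∀ l < L, ∀ i, v (l + 1) h i = x + h • ∑ j, a i j •
      (g h (v l h j) + ε • fderiv ℝ (g h) (v l h j) (v (l + 1) h j - v l h j))

/-- The scheme with stages given by `IsUnrolled`. -/
def unrolledRK (ε : ℝ) (L : ℕ) : Scheme D := fun g x z =>
  ∃ v, IsUnrolled a ε L g x v ∧ ∀ᶠ h in 𝓝 (0 : ℝ), z h = rkUpdate b (g h) h x (v L h)

theorem fixedPointRK_eq_unrolledRK (L : ℕ) :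
    fixedPointRK (D := D) a b L = unrolledRK a b 0 L := by
  funext g x z
  simp only [fixedPointRK, unrolledRK, IsUnrolled, ← eventually_and, and_assoc, zero_smul, add_zero]

theorem newtonRK_eq_unrolledRK (L : ℕ) :
    newtonRK (D := D) a b L = unrolledRK a b 1 L := by
  funext g x z
  simp only [newtonRK, unrolledRK, IsUnrolled, ← eventually_and, and_assoc, one_smul]

variable {a} {ε : ℝ} {L : ℕ} {G : ℝ → State D → State D} {x : State D}
  {v : ℕ → ℝ → Fin s → State D}

/-- Lets the implicit term of a Newton step be absorbed by `isBigO_of_eq_add_smul`. -/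
theorem isBigO_linear_stage (hG : ContDiff ℝ ∞ (Function.uncurry G)) {u e : ℝ → Fin s → State D}
    (hu : Tendsto u (𝓝 0) (𝓝 fun _ => x)) :
    (fun h i => ∑ j, a i j • ε • fderiv ℝ (G h) (u h j) (e h j)) =O[𝓝 0] e :=
  isBigO_pi.2 fun _ => isBigO_sum_smul _ _ fun j =>
    ((isBigO_family_fderiv_apply hG (tendsto_pi_nhds.1 hu j) (fun h => e h j)).const_smul_left
      ε).trans (isBigO_pi.1 (isBigO_refl e (𝓝 0)) j)

theorem IsUnrolled.tendsto (hG : ContDiff ℝ ∞ (Function.uncurry G))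
    (hv : IsUnrolled a ε L G x v) {l : ℕ} (hl : l ≤ L) :
    Tendsto (v l) (𝓝 0) (𝓝 fun _ => x) := by
  induction l with
  | zero =>
    refine tendsto_const_nhds.congr' ?_
    filter_upwards [hv] with h hh
    exact funext fun i => (hh.1 i).symm
  | succ l ih =>
    have hl' := ih (by lia)
    -- The residual of the stage equations at `v l`. The increment equals `r` plus `h` times a
    -- bounded linear image of itself, so it tends to zero with `r`.
    let r : ℝ → Fin s → State D := fun h i => x - v l h i + h • ∑ j, a i j • G h (v l h j)
    have hr : Tendsto r (𝓝 0) (𝓝 0) := by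
      refine tendsto_pi_nhds.2 fun i => ?_
      have h1 : Tendsto (fun h => ∑ j, a i j • G h (v l h j)) (𝓝 0)
          (𝓝 (∑ j, a i j • G 0 x)) :=
        tendsto_finsetSum _ fun j _ => (tendsto_family hG (tendsto_pi_nhds.1 hl' j)).const_smul _
      have h2 := (tendsto_const_nhds (x := x)).sub (tendsto_pi_nhds.1 hl' i)
      have h3 := h2.add ((tendsto_id (α := ℝ) (x := 𝓝 0)).smul h1)
      simpa using h3
    have he : (fun h => v (l + 1) h - v l h) =O[𝓝 0] r := by
      refine isBigO_of_eq_add_smul ?_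
        (isBigO_linear_stage (a := a) (ε := ε) (e := fun h => v (l + 1) h - v l h) hG hl')
      filter_upwards [hv] with h hh
      funext i
      simp only [Pi.sub_apply, Pi.add_apply, Pi.smul_apply, r]
      rw [hh.2 l (by lia) i]
      simp only [smul_add, Finset.sum_add_distrib]
      abel
    have := (he.trans_tendsto hr).add hl'
    simpa using this

/-- The unrolled stages as a `StageForm`. -/
noncomputable def unrolledStageForm (a : Matrix (Fin s) (Fin s) ℝ) (ε : ℝ) (L : ℕ) :
    StageForm b (unrolledRK (D := D) a b ε L) (Fin (L + 1) → Fin s → State D) where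
  ι := ContinuousLinearMap.pi fun _ => ContinuousLinearMap.pi fun _ => .id ℝ _
  π := ContinuousLinearMap.proj (Fin.last L)
  -- The zero head makes the equation for iterate `0` read `V 0 = x`, the starting value.
  T G h V := Fin.cons (0 : Fin s → State D) fun (l : Fin L) i => ∑ j, a i j •
    (G h (V l.castSucc j) + ε • fderiv ℝ (G h) (V l.castSucc j) (V l.succ j - V l.castSucc j))
  π_ι _ _ := rfl
  contDiff_T G hG := by
    have hV : ∀ (l : Fin (L + 1)) (j : Fin s),
        ContDiff ℝ ∞ fun p : ℝ × (Fin (L + 1) → Fin s → State D) => p.2 l j := fun l j =>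
      (contDiff_apply_apply ℝ (State D) l j).comp contDiff_snd
    refine contDiff_pi.2 fun l => Fin.cases ?_ (fun l => contDiff_pi.2 fun i => ?_) l
    · exact contDiff_const
    · refine contDiff_sum_family_apply (fun j => ?_) (a i)
      have h1 := contDiff_fst.prodMk (hV l.castSucc j)
      exact (hG.comp h1).add (ContDiff.const_smul ε
        (((contDiff_family_fderiv hG).comp h1).clm_apply ((hV l.succ j).sub (hV l.castSucc j))))
  T_perturb G K N hG hK h V := by
    funext l
    refine Fin.cases ?_ (fun l => ?_) l
    · simp
    · funext i
      have hd : ∀ y, fderiv ℝ (fun x => G h x + h ^ N • K x) y =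
          fderiv ℝ (G h) y + h ^ N • fderiv ℝ K y := fun y => by
        have h1 := (contDiff_family_apply hG h).differentiable (by simp) y
        have h2 := hK.differentiable (by simp) y
        exact (h1.hasFDerivAt.add (h2.hasFDerivAt.const_smul (h ^ N))).fderiv
      simp only [Fin.cons_succ, Pi.add_apply, Pi.smul_apply, hd, Finset.smul_sum,
        ← Finset.sum_add_distrib, add_apply, smul_apply]
      refine Finset.sum_congr rfl fun j _ => ?_
      module
  scheme_iff G hG x z := by
    constructor
    · rintro ⟨v, hv, hz⟩
      refine ⟨fun h l => v l h, ⟨?_, ?_⟩, hz⟩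
      · exact tendsto_pi_nhds.2 fun l => hv.tendsto hG (Nat.lt_succ_iff.1 l.2)
      · filter_upwards [hv] with h hh
        funext l
        refine Fin.cases ?_ (fun l => ?_) l
        · funext i
          simpa using hh.1 i
        · funext i
          simpa using hh.2 l l.2 i
    · rintro ⟨V, hV, hz⟩
      -- `Fin.ofNat` extends the finite family to all of `ℕ`; indices beyond `L` are never used.
      have hcast : ∀ l (hl : l < L), Fin.ofNat (L + 1) l = (⟨l, hl⟩ : Fin L).castSucc :=
        fun l hl => Fin.ext (Nat.mod_eq_of_lt (by lia))
      have hsucc : ∀ l (hl : l < L), Fin.ofNat (L + 1) (l + 1) = (⟨l, hl⟩ : Fin L).succ :=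
        fun l hl => Fin.ext (Nat.mod_eq_of_lt (by lia))
      have hlast : Fin.ofNat (L + 1) L = Fin.last L := Fin.ext (Nat.mod_eq_of_lt (by lia))
      refine ⟨fun l h => V h (Fin.ofNat (L + 1) l), ?_, ?_⟩
      · filter_upwards [hV.2] with h hh
        refine ⟨fun i => ?_, fun l hl i => ?_⟩
        · have := congrFun (congrFun hh 0) i
          simpa using this
        · have := congrFun (congrFun hh (Fin.succ ⟨l, hl⟩)) i
          rw [hcast l hl, hsucc l hl]
          exact this
      · filter_upwards [hz] with h hh
        rw [hlast]
        exact hh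

variable {b}

/-- If the linearization error of each iteration raises the order `m` of the stages to `q m`, then
the stages after `l` iterations have order `p l`, where `p (l + 1) = q (p l) + 1`. -/
theorem IsUnrolled.isBigO_sub (hG : ContDiff ℝ ∞ (Function.uncurry G))
    (hv : IsUnrolled a ε L G x v) {w : ℝ → Fin s → State D}
    (hw : IsBranch (fun h V i => ∑ j, a i j • G h (V j)) (fun _ => x) w) {q p : ℕ → ℕ}
    (hq : ∀ (m : ℕ) (u y : ℝ → State D), Tendsto u (𝓝 0) (𝓝 x) → Tendsto y (𝓝 0) (𝓝 x) →
      (fun h => u h - y h) =O[𝓝 0] (fun h : ℝ => h ^ m) →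
      (fun h => G h (u h) - G h (y h) - ε • fderiv ℝ (G h) (y h) (u h - y h)) =O[𝓝 0]
        fun h : ℝ => h ^ q m)
    (hp0 : p 0 = 1) (hp : ∀ l, p (l + 1) = q (p l) + 1) {l : ℕ} (hl : l ≤ L) :
    (fun h => w h - v l h) =O[𝓝 0] fun h : ℝ => h ^ p l := by
  induction l with
  | zero =>
    rw [hp0]
    -- The stage system does not involve the weights, so `0` stands in for them.
    refine (hw.isBigO_sub ((exactStageForm a (0 : Fin s → ℝ)).contDiff_T G hG)).congr' ?_ .rfl
    filter_upwards [hv] with h hh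
    rw [funext hh.1]
  | succ l ih =>
    have hl' := hv.tendsto hG (show l ≤ L by lia)
    have h1 : (fun h i => ∑ j, a i j • (G h (w h j) - G h (v l h j) -
        ε • fderiv ℝ (G h) (v l h j) (w h j - v l h j))) =O[𝓝 0] fun h : ℝ => h ^ q (p l) :=
      isBigO_pi.2 fun i => isBigO_sum_smul _ _ fun j =>
        hq (p l) _ _ (tendsto_pi_nhds.1 hw.1 j) (tendsto_pi_nhds.1 hl' j)
          (isBigO_pi.1 (ih (by lia)) j)
    have h2 := isBigO_smul_pow h1
    rw [← hp] at h2
    -- Splitting `w - v l` as `(w - v (l + 1)) + (v (l + 1) - v l)` in the derivative term writes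
    -- the new error as `h` times the linearization error plus `h` times a linear image of the new
    -- error, which is absorbed.
    refine (isBigO_of_eq_add_smul ?_ (isBigO_linear_stage (a := a) (ε := ε)
      (e := fun h => w h - v (l + 1) h) hG hl')).trans h2
    filter_upwards [hv, hw.2] with h hh hwh
    funext i
    have hwi := congrFun hwh i
    simp only [Pi.add_apply, Pi.smul_apply, Pi.sub_apply] at hwi ⊢
    calc w h i - v (l + 1) h i
        = h • ∑ j, a i j • G h (w h j) - h • ∑ j, a i j • (G h (v l h j) +
          ε • fderiv ℝ (G h) (v l h j) (v (l + 1) h j - v l h j)) := by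
          rw [hh.2 l (by lia) i, hwi]
          rw [add_sub_add_left_eq_sub]
      _ = _ := by
          rw [← smul_sub, ← smul_add, ← Finset.sum_sub_distrib, ← Finset.sum_add_distrib]
          congr 1
          refine Finset.sum_congr rfl fun j _ => ?_
          simp only [map_sub]
          module

/-- The exact and the unrolled scheme agree up to one order more than their stages. -/
theorem isBigO_exactRK_sub_unrolledRK (hG : ContDiff ℝ ∞ (Function.uncurry G)) {q p : ℕ → ℕ}
    (hq : ∀ (m : ℕ) (u y : ℝ → State D), Tendsto u (𝓝 0) (𝓝 x) → Tendsto y (𝓝 0) (𝓝 x) →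
      (fun h => u h - y h) =O[𝓝 0] (fun h : ℝ => h ^ m) →
      (fun h => G h (u h) - G h (y h) - ε • fderiv ℝ (G h) (y h) (u h - y h)) =O[𝓝 0]
        fun h : ℝ => h ^ q m)
    (hp0 : p 0 = 1) (hp : ∀ l, p (l + 1) = q (p l) + 1) {z z' : ℝ → State D}
    (hz : exactRK a b G x z) (hz' : unrolledRK a b ε L G x z') :
    (fun h => z h - z' h) =O[𝓝 0] fun h : ℝ => h ^ (p L + 1) := by
  obtain ⟨w, hw, hzw⟩ := ((exactStageForm a b).scheme_iff G hG x z).1 hz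
  obtain ⟨v, hv, hzv⟩ := hz'
  have h1 := hv.isBigO_sub hG hw hq hp0 hp le_rfl
  have h2 : ∀ i, (fun h => G h (w h i) - G h (v L h i)) =O[𝓝 0] fun h : ℝ => h ^ p L := fun i =>
    (isBigO_family_sub hG (tendsto_pi_nhds.1 hw.1 i)
      (tendsto_pi_nhds.1 (hv.tendsto hG le_rfl) i)).trans (isBigO_pi.1 h1 i)
  refine (isBigO_smul_pow (isBigO_sum_smul Finset.univ b h2)).congr' ?_ .rfl
  filter_upwards [hzw, hzv] with h e1 e2
  rw [e1, e2]
  simp only [rkUpdate, smul_sub, Finset.sum_sub_distrib, add_sub_add_left_eq_sub]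
  rfl

theorem isBigO_exactRK_sub_fixedPointRK (hG : ContDiff ℝ ∞ (Function.uncurry G))
    {z z' : ℝ → State D} (hz : exactRK a b G x z) (hz' : fixedPointRK a b L G x z') :
    (fun h => z h - z' h) =O[𝓝 0] fun h : ℝ => h ^ (L + 2) := by
  rw [fixedPointRK_eq_unrolledRK] at hz'
  -- For `ε = 0` only the Lipschitz bound is available, so `q` preserves the order.
  refine isBigO_exactRK_sub_unrolledRK hG (q := id) (p := fun l => l + 1)
    (fun m u y hu hy huy => ?_) rfl (fun l => rfl) hz hz'
  simpa using (isBigO_family_sub hG hu hy).trans huy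

theorem isBigO_exactRK_sub_newtonRK (hG : ContDiff ℝ ∞ (Function.uncurry G))
    {z z' : ℝ → State D} (hz : exactRK a b G x z) (hz' : newtonRK a b L G x z') :
    (fun h => z h - z' h) =O[𝓝 0] fun h : ℝ => h ^ (2 ^ (L + 1) - 2 + 2) := by
  rw [newtonRK_eq_unrolledRK] at hz'
  have hpow : ∀ l : ℕ, 1 ≤ 2 ^ l := fun l => Nat.one_le_two_pow
  -- The quadratic remainder doubles the order; `p (l + 1) = 2 * p l + 1` with `p 0 = 1` has the
  -- solution `2 ^ (l + 1) - 1`.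
  have h1 := isBigO_exactRK_sub_unrolledRK hG (q := fun m => 2 * m) (p := fun l => 2 ^ (l + 1) - 1)
    (fun m u y hu hy huy => ?_) rfl (fun l => ?_) hz hz'
  · have h2 : 2 ^ (L + 1) - 2 + 2 = 2 ^ (L + 1) - 1 + 1 := by
      have := hpow L
      rw [pow_succ]; lia
    rwa [h2]
  · have h3 := (isBigO_family_taylor hG hu hy).trans (huy.norm_left.pow 2)
    simpa only [one_smul, ← pow_mul, mul_comm m 2] using h3
  · have := hpow l
    rw [pow_succ 2 (l + 1), pow_succ 2 l]; lia

end Schemes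

/-! ### Existence, uniqueness and comparison of inverse modified equations -/

section InverseModifiedEquation

variable {D s : ℕ} {Φ Ψ : Scheme D} {f : State D → State D}

theorem contDiff_truncation {F : ℕ → State D → State D} (hF : ∀ k, ContDiff ℝ ∞ (F k)) (N : ℕ) :
    ContDiff ℝ ∞ (Function.uncurry (truncation F N)) := by
  change ContDiff ℝ ∞ fun p : ℝ × State D => ∑ k ∈ Finset.range (N + 1), p.1 ^ k • F k p.2
  exact ContDiff.sum fun k _ => (contDiff_fst.pow k).smul ((hF k).comp contDiff_snd)

/-- A vector field whose scheme has the expansion `∑ h ^ j • d j` up to `h ^ N` can be corrected at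
order `N` so that the expansion holds up to `h ^ (N + 1)`. -/
theorem IsRegular.exists_correction (hΦ : IsRegular Φ) {d : ℕ → State D → State D}
    (hd : ∀ j, ContDiff ℝ ∞ (d j)) {G : ℝ → State D → State D}
    (hG : ContDiff ℝ ∞ (Function.uncurry G)) {N : ℕ}
    (h : ∀ x z, Φ G x z → ExpandsTo z (fun j => d j x) N) :
    ∃ K : State D → State D, ContDiff ℝ ∞ K ∧
      ∀ x z, Φ (fun h x => G h x + h ^ N • K x) x z → ExpandsTo z (fun j => d j x) (N + 1) := by
  obtain ⟨c, hc, hcz⟩ := hΦ.exists_coeff G hG (N + 2)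
  -- The correction is the defect of the `h ^ (N + 1)` coefficient, the first one that may be wrong.
  refine ⟨fun x => d (N + 1) x - c (N + 1) x, (hd _).sub (hc _), fun x z hz => ?_⟩
  obtain ⟨z₀, hz₀, hz₀c⟩ := hcz x
  have hcd : ∀ j < N + 1, c j x = d j x := by
    refine coeff_eq_of_isBigO (z := z₀) ?_ (h x z₀ hz₀)
    have h1 := isBigO_pow_smul (u := fun _ => c (N + 1) x)
      (isBigO_const_const _ one_ne_zero _) (N + 1)
    refine ((hz₀c.trans (isBigO_pow_of_le (Nat.le_succ (N + 1)))).add h1).congr_left fun t => ?_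
    rw [Finset.sum_range_succ]; abel
  have h2 := hΦ.isBigO_perturb G _ N hG ((hd (N + 1)).sub (hc (N + 1))) x z₀ z hz₀ hz
  refine (h2.add hz₀c).congr_left fun t => ?_
  rw [Finset.sum_range_succ, Finset.sum_range_succ (n := N + 1), smul_sub,
    Finset.sum_congr rfl fun j hj => by rw [hcd j (Finset.mem_range.1 hj)]]
  abel

theorem IsRegular.exists_isIMDE (hΦ : IsRegular Φ) (hf : ContDiff ℝ ∞ f) :
    ∃ F, IsIMDE Φ f F := by
  let Good : ℕ → (ℝ → State D → State D) → Prop := fun N G =>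
    ContDiff ℝ ∞ (Function.uncurry G) ∧ ∀ x z, Φ G x z → ExpandsTo z (fun j => flowCoeff f j x) N
  have hstep : ∀ N G, ∃ K : State D → State D, ContDiff ℝ ∞ K ∧
      (Good N G → Good (N + 1) fun h x => G h x + h ^ N • K x) := by
    intro N G
    -- The correction is made total, with junk value `0`, so that it can be chosen before the
    -- recursion is run.
    by_cases hG : Good N G
    · obtain ⟨K, hK, hKz⟩ := hΦ.exists_correction (contDiff_flowCoeff hf) hG.1 hG.2
      exact ⟨K, hK, fun _ => ⟨contDiff_perturb hG.1 hK N, hKz⟩⟩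
    · exact ⟨0, contDiff_const, fun h => (hG h).elim⟩
  choose K hK hKG using hstep
  let g : ℕ → ℝ → State D → State D :=
    Nat.rec (fun _ _ => 0) fun N G h x => G h x + h ^ N • K N G x
  have hg0 : Good 0 (g 0) := by
    refine ⟨contDiff_const, fun x z hz => ?_⟩
    have := hΦ.isBigO_sub (g 0) contDiff_const x z hz
    simpa [ExpandsTo, flowCoeff, lieIterate] using this
  have hg : ∀ N, Good N (g N) := fun N => by
    induction N with
    | zero => exact hg0
    | succ N ih => exact hKG N (g N) ih
  let F : ℕ → State D → State D := fun N => K N (g N)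
  have hFg : ∀ N, truncation F N = g (N + 1) := by
    have : ∀ N h x, ∑ k ∈ Finset.range N, h ^ k • F k x = g N h x := fun N h x => by
      induction N with
      | zero => rfl
      | succ N ih => rw [Finset.sum_range_succ, ih]
    exact fun N => funext fun h => funext fun x => this (N + 1) h x
  refine ⟨F, fun k => hK k (g k), fun x => ⟨_, isExactSeries_flowCoeff hf x, fun N => ?_⟩⟩
  rw [hFg]
  obtain ⟨_, _, hz⟩ := hΦ.exists_coeff (g (N + 1)) (hg (N + 1)).1 0
  obtain ⟨z, hz, -⟩ := hz x
  exact ⟨z, hz, (hg (N + 1)).2 x z hz⟩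

/-- If two schemes agree up to `h ^ (M + 1)`, then so do their inverse modified equations up to
`h ^ M`. -/
theorem IsIMDE.eq_of_isBigO (hΦ : IsRegular Φ) (hf : ContDiff ℝ ∞ f) {M : ℕ}
    (hΦΨ : ∀ G, ContDiff ℝ ∞ (Function.uncurry G) → ∀ x z z', Φ G x z → Ψ G x z' →
      (fun h => z h - z' h) =O[𝓝 0] fun h : ℝ => h ^ (M + 2))
    {F F' : ℕ → State D → State D} (hF : IsIMDE Φ f F) (hF' : IsIMDE Ψ f F') :
    ∀ k ≤ M, F k = F' k := by
  intro k
  induction k using Nat.strong_induction_on with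
  | _ k ih =>
    intro hk
    funext x
    obtain ⟨d, hd, hFd⟩ := hF.2 x
    obtain ⟨d', hd', hFd'⟩ := hF'.2 x
    rw [hd.eq_flowCoeff hf] at hFd
    rw [hd'.eq_flowCoeff hf] at hFd'
    obtain ⟨z, hz, hzd⟩ := hFd k
    obtain ⟨z', hz', hzd'⟩ := hFd' k
    have hG := contDiff_truncation hF'.1 k
    -- The intermediate output `w` runs `Φ` on the truncation of `F'`: `z - w` measures the change
    -- of field, `w - z'` the change of scheme. Order `0` suffices, as only the existence of `w` is
    -- needed.
    obtain ⟨_, _, hw⟩ := hΦ.exists_coeff _ hG 0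
    obtain ⟨w, hw, -⟩ := hw x
    have htr : truncation F k =
        fun h x => truncation F' k h x + h ^ k • (F k x - F' k x) := by
      funext h y
      simp only [truncation, Finset.sum_range_succ]
      rw [Finset.sum_congr rfl fun j hj => by
        rw [ih j (Finset.mem_range.1 hj) ((Finset.mem_range.1 hj).le.trans hk)], smul_sub]
      abel
    rw [htr] at hz
    have h1 := hΦ.isBigO_perturb _ (fun y => F k y - F' k y) k hG ((hF.1 k).sub (hF'.1 k))
      x w z hw hz
    have h2 := (hΦΨ _ hG x w z' hw hz').trans (isBigO_pow_of_le (show k + 2 ≤ M + 2 by lia))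
    rw [← sub_eq_zero]
    refine eq_zero_of_pow_smul_isBigO (n := k + 1) ?_
    refine (((hzd.sub hzd').sub h1).sub h2).congr_left fun t => ?_
    abel

theorem IsRegular.existsUnique_isIMDE (hΦ : IsRegular Φ) (hf : ContDiff ℝ ∞ f) :
    ∃! F, IsIMDE Φ f F := by
  obtain ⟨F, hF⟩ := hΦ.exists_isIMDE hf
  refine ⟨F, hF, fun F' hF' => funext fun k =>
    IsIMDE.eq_of_isBigO (M := k) hΦ hf (fun G hG x z z' hz hz' => ?_) hF' hF k le_rfl⟩
  -- Perturbing by the zero field shows that any two outputs of `Φ` for the same field agree to the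
  -- required order.
  have h0 : (fun h x => G h x + h ^ k • (0 : State D → State D) x) = G := by
    funext h x; simp
  have := hΦ.isBigO_perturb G 0 k hG contDiff_const x z' z hz' (by rwa [h0])
  simpa using this

end InverseModifiedEquation

end UnrolledRK

theorem mainTheorem2 {D s : ℕ} (a : Matrix (Fin s) (Fin s) ℝ) (b : Fin s → ℝ)
    (hb : ∑ i, b i = 1) (L : ℕ)
    (f : UnrolledRK.State D → UnrolledRK.State D) (hf : ContDiff ℝ ∞ f) :
    (∃! fHat, UnrolledRK.IsIMDE (UnrolledRK.exactRK a b) f fHat) ∧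
    (∃! F, UnrolledRK.IsIMDE (UnrolledRK.fixedPointRK a b L) f F) ∧
    (∃! F, UnrolledRK.IsIMDE (UnrolledRK.newtonRK a b L) f F) ∧
    (∀ fHat F, UnrolledRK.IsIMDE (UnrolledRK.exactRK a b) f fHat →
      UnrolledRK.IsIMDE (UnrolledRK.fixedPointRK a b L) f F →
      ∀ k ≤ L, fHat k = F k) ∧
    (∀ fHat F, UnrolledRK.IsIMDE (UnrolledRK.exactRK a b) f fHat →
      UnrolledRK.IsIMDE (UnrolledRK.newtonRK a b L) f F →
      ∀ k ≤ 2 ^ (L + 1) - 2, fHat k = F k) := by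
  have hE : UnrolledRK.IsRegular (UnrolledRK.exactRK (D := D) a b) :=
    (UnrolledRK.exactStageForm a b).isRegular hb
  have hP : UnrolledRK.IsRegular (UnrolledRK.fixedPointRK (D := D) a b L) :=
    UnrolledRK.fixedPointRK_eq_unrolledRK a b L ▸ (UnrolledRK.unrolledStageForm b a 0 L).isRegular hb
  have hN : UnrolledRK.IsRegular (UnrolledRK.newtonRK (D := D) a b L) :=
    UnrolledRK.newtonRK_eq_unrolledRK a b L ▸ (UnrolledRK.unrolledStageForm b a 1 L).isRegular hb
  exact ⟨hE.existsUnique_isIMDE hf, hP.existsUnique_isIMDE hf, hN.existsUnique_isIMDE hf,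
    fun _ _ h h' => h.eq_of_isBigO hE hf
      (fun _ hG _ _ _ => UnrolledRK.isBigO_exactRK_sub_fixedPointRK hG) h',
    fun _ _ h h' => h.eq_of_isBigO hE hf
      (fun _ hG _ _ _ => UnrolledRK.isBigO_exactRK_sub_newtonRK hG) h'⟩
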